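/- A hypergraph $h=(I,E)$ consists of a finite set $I$ of nodes and a finite multiset $E$ of non-empty subsets of $I$, called hyperedges (repeated hyperedges and one-element hyperedges are allowed). A heading of $h$ is a map $\sigma\colon E\to I$ with $\sigma(e)\in e$ for every $e\in E$ (copies of the same hyperedge are treated as different elements of $E$); $\sigma(e)$ is called the head of $e$. A heading is acyclic if there is no sequence $e_1,\dots,e_\ell$ $(\ell\ge 1)$ of hyperedges with $\sigma(e_k)\in e_{k+1}\setminus\{\sigma(e_{k+1})\}$ for all $k=1,\dots,\ell$, where $e_{\ell+1}=e_1$. An $m$-coloring of $h$ is a map $c\colon I\to[m]=\{1,\dots,m\}$. It is proper if every hyperedge $e$ contains exactly one node $i$ with $c(i)=\max_{j\in e}c(j)$. A heading $\sigma$ and an $m$-coloring $c$ (not necessarily proper) are compatible if $c(\sigma(e))=\max_{j\in e}c(j)$ for every $e\in E$. Theorem. Let $h=(I,E)$ be a hypergraph with $d=|I|$ nodes. There is a unique polynomial $\chi_d(h)\in\mathbb{Q}[x]$ such that, for every positive integer $m$, $\chi_d(h)(m)$ is the number of proper $m$-colorings of $h$. For every positive integer $m$, $$(-1)^d\,\chi_d(h)(-m)=\#\{(\sigma,c)\;:\;\sigma\text{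 an acyclic heading of }h,\ c\text{ an } m\text{-coloring of }h,\ \sigma\text{ and }c\text{ compatible}\}.$$ In particular, $(-1)^d\,\chi_d(h)(-1)$ is the number of acyclic headings of $h$. -/

import Mathlib

open Polynomial

/-- A hypergraph on the node set `I`: a finite multiset of non-empty subsets of `I`, the hyperedges.
Repeated hyperedges and hyperedges with a single node are allowed. -/
structure MultiHypergraph (I : Type*) where
  /-- The multiset of hyperedges. -/
  edges : Multiset (Finset I)
  /-- Hyperedges are non-empty. -/
  nonempty_of_mem : ∀ e ∈ edges, e.Nonempty

namespace MultiHypergraph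

/-- The type of hyperedges of `h` counted with multiplicity; the underlying set of nodes
of `e : h.Edge` is `e.1`. -/
abbrev Edge {I : Type*} [DecidableEq I] (h : MultiHypergraph I) : Type _ :=
  h.edges.ToType

/-- A heading of `h` picks for every hyperedge (each copy separately) a node of that hyperedge,
its head. -/
def Heading {I : Type*} [DecidableEq I] (h : MultiHypergraph I) : Type _ :=
  {σ : h.Edge → I // ∀ e : h.Edge, σ e ∈ e.1}

namespace Heading

/-- The head of a hyperedge. -/
def head {I : Type*} [DecidableEq I] {h : MultiHypergraph I} (σ : h.Heading) (e : h.Edge) : I :=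
  σ.1 e

/-- The sequence `e 0, …, e n` of hyperedges is an oriented cycle of `σ`: the head of each
hyperedge is a node, different from the head, of the cyclically next one (the addition `i + 1`
is taken in `Fin (n + 1)`, so it is cyclic). -/
def IsOrientedCycle {I : Type*} [DecidableEq I] {h : MultiHypergraph I} (σ : h.Heading)
    {n : ℕ} (e : Fin (n + 1) → h.Edge) : Prop :=
  ∀ i : Fin (n + 1), σ.head (e i) ∈ (e (i + 1)).1 \ {σ.head (e (i + 1))}

/-- A heading is acyclic if it has no oriented cycle (of any length at least one). -/
def IsAcyclic {I : Type*} [DecidableEq I] {h : MultiHypergraph I} (σ : h.Heading) : Prop :=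
  ¬ ∃ (n : ℕ) (e : Fin (n + 1) → h.Edge), σ.IsOrientedCycle e

end Heading

/-- The node `i` of the hyperedge `e` has maximal color among the nodes of `e`. -/
def IsMaximalNode {I : Type*} {m : ℕ} (c : I → Fin m) (e : Finset I) (i : I) : Prop :=
  i ∈ e ∧ ∀ j ∈ e, c j ≤ c i

/-- A coloring with `m` colors is proper if every hyperedge has a unique maximal node. -/
def IsProperColoring {I : Type*} (h : MultiHypergraph I) {m : ℕ} (c : I → Fin m) : Prop :=
  ∀ e ∈ h.edges, ∃! i : I, IsMaximalNode c e i

/-- A heading and a coloring are compatible if the head of each hyperedge has maximal color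
in that hyperedge. -/
def Compatible {I : Type*} [DecidableEq I] {h : MultiHypergraph I} {m : ℕ}
    (σ : h.Heading) (c : I → Fin m) : Prop :=
  ∀ e : h.Edge, IsMaximalNode c e.1 (σ.head e)

/-- `χ` is the coloring polynomial of `h`: for every positive integer `m`, the value `χ(m)` is the
number of proper colorings of `h` with `m` colors. -/
def IsColoringPolynomial {I : Type*} (h : MultiHypergraph I) (χ : ℚ[X]) : Prop :=
  ∀ m : ℕ, 0 < m → χ.eval (m : ℚ) = (Nat.card {c : I → Fin m // h.IsProperColoring c} : ℚ)

end MultiHypergraph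

/-! A proper coloring singles out a heading, the unique maximal node of each hyperedge. It is
strictly increasing for the relation `Below` of that heading, which forces the heading to be
acyclic. So proper colorings split over acyclic headings into strict maps, while compatible pairs
split into weak maps (`sigmaEquivProperColoring`, `sigmaEquivCompatible`). It remains to apply
Stanley's reciprocity between strict and weak maps to each heading and sum (`exists_reciprocity`).

Reciprocity goes by induction on the ground set `A`. Removing the top-colored set `U` expresses the
strict count at `m + 1` through the counts on `A \ U` at `m`; inclusion-exclusion over `U` gives the
weak counts the same recursion with signs, run backwards in `m`. A discrete antiderivative vanishing
at `0` satisfies both. -/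

/-- Every rational polynomial is the forward difference of a polynomial vanishing at `0`. -/
theorem Polynomial.exists_eval_add_one_sub_eval (Q : ℚ[X]) :
    ∃ P : ℚ[X], P.eval 0 = 0 ∧ ∀ x : ℚ, P.eval (x + 1) = P.eval x + Q.eval x := by
  induction Q using Polynomial.induction_on' with
  | add p q hp hq =>
    obtain ⟨P, hP0, hP⟩ := hp
    obtain ⟨P', hP0', hP'⟩ := hq
    refine ⟨P + P', by simp [hP0, hP0'], fun x => ?_⟩
    simp only [eval_add, hP, hP']
    ring
  | monomial n a =>
    -- Bernoulli polynomials satisfy `B_{n+1}(x + 1) - B_{n+1}(x) = (n + 1) x ^ n`; subtracting the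
    -- constant gives value `0` at `0`.
    refine ⟨C (a / (n + 1)) * (Polynomial.bernoulli (n + 1) -
      C ((Polynomial.bernoulli (n + 1)).eval 0)), by simp, fun x => ?_⟩
    have h : (n : ℚ) + 1 ≠ 0 := by positivity
    rw [add_comm x 1]
    simp only [eval_mul, eval_C, eval_sub, Polynomial.bernoulli_eval_one_add, eval_monomial]
    push_cast
    field_simp
    ring

/-! ### Order polynomials of a relation and their reciprocity -/

namespace OrderPolynomial

variable {I : Type*} [Fintype I] [DecidableEq I]

open Classical in
/-- The maps that take values in `{1, …, m}` on `A`, vanish outside `A`, and respect the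
relations `R` on `A` and `S` on `ℕ`. -/
noncomputable def relMaps (R : I → I → Prop) (S : ℕ → ℕ → Prop) (A : Finset I) (m : ℕ) :
    Finset (I → ℕ) :=
  {c ∈ Fintype.piFinset fun i => if i ∈ A then Finset.Icc 1 m else {0} |
    ∀ i ∈ A, ∀ j ∈ A, R i j → S (c i) (c j)}

open Classical in
/-- The elements of `A` without `R`-successor in `A`. -/
noncomputable def maxElems (R : I → I → Prop) (A : Finset I) : Finset I :=
  {i ∈ A | ∀ j ∈ A, ¬ R i j}

theorem mem_maxElems {R : I → I → Prop} {A : Finset I} {i : I} :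
    i ∈ maxElems R A ↔ i ∈ A ∧ ∀ j ∈ A, ¬ R i j := by
  simp [maxElems]

theorem mem_relMaps {R : I → I → Prop} {S : ℕ → ℕ → Prop} {A : Finset I} {m : ℕ} {c : I → ℕ} :
    c ∈ relMaps R S A m ↔ (∀ i ∈ A, 1 ≤ c i ∧ c i ≤ m) ∧ (∀ i ∉ A, c i = 0) ∧
      ∀ i ∈ A, ∀ j ∈ A, R i j → S (c i) (c j) := by
  simp only [relMaps, Finset.mem_filter, Fintype.mem_piFinset]
  rw [← and_assoc]
  refine and_congr_left fun _ => ⟨fun h => ⟨fun i hi => ?_, fun i hi => ?_⟩, fun h i => ?_⟩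
  · simpa [hi] using h i
  · simpa [hi] using h i
  · by_cases hi : i ∈ A
    · simpa [hi] using h.1 i hi
    · simpa [hi] using h.2 i hi

theorem card_relMaps_empty (R : I → I → Prop) (S : ℕ → ℕ → Prop) (m : ℕ) :
    (relMaps R S ∅ m).card = 1 := by
  rw [Finset.card_eq_one]
  refine ⟨0, Finset.ext fun c => ?_⟩
  simp [mem_relMaps, funext_iff]

theorem card_relMaps_zero (R : I → I → Prop) (S : ℕ → ℕ → Prop) {A : Finset I}
    (hA : A.Nonempty) : (relMaps R S A 0).card = 0 := by
  obtain ⟨i, hi⟩ := hA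
  rw [Finset.card_eq_zero, Finset.eq_empty_iff_forall_notMem]
  intro c hc
  have := (mem_relMaps.1 hc).1 i hi
  omega

/-- Strict maps whose set of elements of top value is `U`. -/
theorem card_strict_fiber (R : I → I → Prop) {A U : Finset I} (hU : U ⊆ maxElems R A) (m : ℕ) :
    {c ∈ relMaps R (· < ·) A (m + 1) | ({i ∈ A | c i = m + 1} : Finset I) = U}.card =
      (relMaps R (· < ·) (A \ U) m).card := by
  -- Erasing the top layer resets it to `0`, the value outside the ground set; the inverse restores
  -- `m + 1`.
  refine Finset.card_bij' (fun c _ i => if i ∈ U then 0 else c i)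
    (fun c _ i => if i ∈ U then m + 1 else c i) ?_ ?_ ?_ ?_
  · intro c hc
    obtain ⟨hc', rfl⟩ := Finset.mem_filter.1 hc
    obtain ⟨h1, h2, h3⟩ := mem_relMaps.1 hc'
    simp only [mem_relMaps, Finset.mem_sdiff, Finset.mem_filter]
    grind
  · intro c hc
    obtain ⟨h1, h2, h3⟩ := mem_relMaps.1 hc
    simp only [mem_relMaps, Finset.mem_sdiff, Finset.mem_filter] at *
    have hU' : ∀ i ∈ U, i ∈ A ∧ ∀ j ∈ A, ¬ R i j := fun i hi => mem_maxElems.1 (hU hi)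
    refine ⟨⟨?_, ?_, ?_⟩, ?_⟩
    · grind
    · grind
    · grind
    · ext i
      have := hU' i
      have := h1 i
      grind
  · intro c hc
    obtain ⟨-, rfl⟩ := Finset.mem_filter.1 hc
    funext i
    grind
  · intro c hc
    obtain ⟨h1, h2, h3⟩ := mem_relMaps.1 hc
    funext i
    grind

/-- An element of top value in a strict map has no successor in `A`, so the top layer is a set of
maximal elements, and each such set may occur. -/
theorem card_strict_succ (R : I → I → Prop) (A : Finset I) (m : ℕ) :
    (relMaps R (· < ·) A (m + 1)).card =
      ∑ U ∈ (maxElems R A).powerset, (relMaps R (· < ·) (A \ U) m).card := by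
  rw [Finset.card_eq_sum_card_fiberwise (f := fun c => ({i ∈ A | c i = m + 1} : Finset I))
    (t := (maxElems R A).powerset)]
  · exact Finset.sum_congr rfl fun U hU => card_strict_fiber R (Finset.mem_powerset.1 hU) m
  · intro c hc
    obtain ⟨h1, h2, h3⟩ := mem_relMaps.1 (Finset.mem_coe.1 hc)
    simp only [Finset.coe_powerset, Set.mem_preimage, Set.mem_powerset_iff, Finset.coe_subset]
    intro i hi
    obtain ⟨hiA, hi⟩ := Finset.mem_filter.1 hi
    refine mem_maxElems.2 ⟨hiA, fun j hj hij => ?_⟩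
    have := h3 i hiA j hj hij
    have := h1 j hj
    omega

/-- Weak maps that take the top value on a set `U` of maximal elements. -/
theorem card_weak_fiber (R : I → I → Prop) {A U : Finset I} (hU : U ⊆ maxElems R A) (m : ℕ) :
    {c ∈ relMaps R (· ≤ ·) A (m + 1) | U ⊆ ({i ∈ maxElems R A | c i = m + 1} : Finset I)}.card =
      (relMaps R (· ≤ ·) (A \ U) (m + 1)).card := by
  have hU' : ∀ i ∈ U, i ∈ A ∧ ∀ j ∈ A, ¬ R i j := fun i hi => mem_maxElems.1 (hU hi)
  refine Finset.card_bij' (fun c _ i => if i ∈ U then 0 else c i)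
    (fun c _ i => if i ∈ U then m + 1 else c i) ?_ ?_ ?_ ?_
  · intro c hc
    obtain ⟨hc, hcU⟩ := Finset.mem_filter.1 hc
    obtain ⟨h1, h2, h3⟩ := mem_relMaps.1 hc
    simp only [mem_relMaps, Finset.mem_sdiff]
    grind
  · intro c hc
    obtain ⟨h1, h2, h3⟩ := mem_relMaps.1 hc
    simp only [mem_relMaps, Finset.mem_sdiff, Finset.mem_filter] at *
    refine ⟨⟨?_, ?_, ?_⟩, ?_⟩
    · grind
    · grind
    · grind
    · grind
  · intro c hc
    obtain ⟨hc, hcU⟩ := Finset.mem_filter.1 hc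
    funext i
    grind
  · intro c hc
    obtain ⟨h1, h2, h3⟩ := mem_relMaps.1 hc
    funext i
    grind

/-- Acyclicity of a relation on a finite type, in the form of existence of maximal elements. -/
def HasMaxElems (R : I → I → Prop) : Prop :=
  ∀ A : Finset I, A.Nonempty → ∃ i ∈ A, ∀ j ∈ A, ¬ R i j

theorem filter_weak_succ {R : I → I → Prop} (hR : HasMaxElems R) (A : Finset I) (m : ℕ) :
    {c ∈ relMaps R (· ≤ ·) A (m + 1) | ({i ∈ maxElems R A | c i = m + 1} : Finset I) = ∅} =
      relMaps R (· ≤ ·) A m := by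
  ext c
  rw [Finset.mem_filter, mem_relMaps, mem_relMaps, Finset.filter_eq_empty_iff]
  constructor
  · rintro ⟨⟨h1, h2, h3⟩, h4⟩
    refine ⟨fun i hi => ⟨(h1 i hi).1, ?_⟩, h2, h3⟩
    by_contra hlt
    -- A successor of a top-valued element is top-valued under a weak map, so a maximal element of
    -- the top layer is maximal in `A`.
    obtain ⟨k, hk, hmax⟩ := hR {i ∈ A | c i = m + 1}
      ⟨i, Finset.mem_filter.2 ⟨hi, by have := h1 i hi; omega⟩⟩
    obtain ⟨hkA, hk⟩ := Finset.mem_filter.1 hk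
    refine h4 (mem_maxElems.2 ⟨hkA, fun j hj hkj => ?_⟩) hk
    refine hmax j (Finset.mem_filter.2 ⟨hj, ?_⟩) hkj
    have := h3 k hkA j hj hkj
    have := h1 j hj
    omega
  · rintro ⟨h1, h2, h3⟩
    refine ⟨⟨fun i hi => ?_, h2, h3⟩, fun i hi => ?_⟩
    · have := h1 i hi
      omega
    · have := h1 i (mem_maxElems.1 hi).1
      omega

/-- Inclusion-exclusion: weak maps avoiding the value `m + 1` are those taking it at no maximal
element, and the alternating sum over subsets of the set where it is taken detects emptiness. -/
theorem card_weak_eq_alternating_sum {R : I → I → Prop} (hR : HasMaxElems R) (A : Finset I)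
    (m : ℕ) :
    ((relMaps R (· ≤ ·) A m).card : ℚ) =
      ∑ U ∈ (maxElems R A).powerset,
        (-1 : ℚ) ^ U.card * ((relMaps R (· ≤ ·) (A \ U) (m + 1)).card : ℚ) := by
  have key : ∀ T : Finset I, ∑ U ∈ T.powerset, (-1 : ℚ) ^ U.card = if T = ∅ then 1 else 0 := by
    intro T
    have := Finset.sum_powerset_neg_one_pow_card (x := T)
    exact_mod_cast this
  rw [← filter_weak_succ hR, Finset.card_filter]
  push_cast
  simp_rw [← key]
  have h1 : ∀ U ∈ (maxElems R A).powerset,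
      (-1 : ℚ) ^ U.card * ((relMaps R (· ≤ ·) (A \ U) (m + 1)).card : ℚ) =
      ∑ c ∈ relMaps R (· ≤ ·) A (m + 1),
        if U ⊆ ({i ∈ maxElems R A | c i = m + 1} : Finset I) then (-1 : ℚ) ^ U.card else 0 := by
    intro U hU
    rw [← card_weak_fiber R (Finset.mem_powerset.1 hU), Finset.card_filter]
    push_cast
    rw [Finset.mul_sum]
    exact Finset.sum_congr rfl fun c _ => by simp
  rw [Finset.sum_congr rfl h1, Finset.sum_comm]
  refine Finset.sum_congr rfl fun c _ => ?_
  rw [← Finset.sum_filter]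
  refine Finset.sum_congr (Finset.ext fun U => ?_) fun _ _ => rfl
  simp only [Finset.mem_powerset, Finset.mem_filter]
  exact ⟨fun h => ⟨h.trans (Finset.filter_subset _ _), h⟩, fun h => h.2⟩

/-- Reciprocity for order polynomials. -/
theorem exists_reciprocity {R : I → I → Prop} (hR : HasMaxElems R) (A : Finset I) :
    ∃ P : ℚ[X], (∀ m : ℕ, P.eval (m : ℚ) = (relMaps R (· < ·) A m).card) ∧
      ∀ m : ℕ, (-1 : ℚ) ^ A.card * P.eval (-(m : ℚ)) = (relMaps R (· ≤ ·) A m).card := by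
  induction A using Finset.strongInduction with
  | H A ih =>
    rcases A.eq_empty_or_nonempty with rfl | hA
    · exact ⟨1, fun m => by simp [card_relMaps_empty], fun m => by simp [card_relMaps_empty]⟩
    choose! p hp hq using ih
    set N := (maxElems R A).powerset.erase ∅ with hN
    have hsub : ∀ U ∈ N, A \ U ⊂ A ∧ U ⊆ A := by
      intro U hU
      obtain ⟨hne, hU⟩ := Finset.mem_erase.1 hU
      have hUA : U ⊆ A := fun i hi => (mem_maxElems.1 (Finset.mem_powerset.1 hU hi)).1
      exact ⟨Finset.sdiff_ssubset hUA (Finset.nonempty_iff_ne_empty.2 hne), hUA⟩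
    have hsplit : ∀ f : Finset I → ℚ, ∑ U ∈ (maxElems R A).powerset, f U = f ∅ + ∑ U ∈ N, f U :=
      fun f => (Finset.add_sum_erase _ f (Finset.empty_mem_powerset _)).symm
    -- The difference equation is the strict recursion with the term `U = ∅` moved to the left;
    -- `P(0) = 0` because a nonempty `A` has no map into no colors.
    obtain ⟨P, hP0, hP⟩ := Polynomial.exists_eval_add_one_sub_eval (∑ U ∈ N, p (A \ U))
    refine ⟨P, fun m => ?_, fun m => ?_⟩
    · induction m with
      | zero => simp [hP0, card_relMaps_zero _ _ hA]
      | succ m ihm =>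
        rw [card_strict_succ]
        push_cast
        rw [hP, ihm, hsplit, Finset.sdiff_empty, eval_finsetSum]
        exact congrArg _ (Finset.sum_congr rfl fun U hU => hp _ (hsub U hU).1 m)
    · induction m with
      | zero => simp [hP0, card_relMaps_zero _ _ hA]
      | succ m ihm =>
        -- At `-(m + 1)` the difference equation becomes the alternating weak recursion, since `(-1)
        -- ^ |A| = (-1) ^ |A \ U| * (-1) ^ |U|`.
        have h := hP (-((m + 1 : ℕ) : ℚ))
        rw [show -((m + 1 : ℕ) : ℚ) + 1 = -(m : ℚ) by push_cast; ring, eval_finsetSum] at h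
        have h2 := card_weak_eq_alternating_sum hR A m
        rw [hsplit, Finset.card_empty, pow_zero, one_mul, Finset.sdiff_empty, ← ihm, h, mul_add,
          Finset.mul_sum] at h2
        refine add_right_cancel (h2.trans (congrArg _ (Finset.sum_congr rfl fun U hU => ?_)))
        obtain ⟨hss, hUA⟩ := hsub U hU
        rw [← hq _ hss, ← Finset.card_sdiff_add_card_eq_card hUA, pow_add]
        ring

/-- Colorings by `Fin m` as maps with values in `{1, …, m}`. -/
theorem natCard_eq_card_relMaps (R : I → I → Prop) (S : ℕ → ℕ → Prop)
    (hS : ∀ a b, S (a + 1) (b + 1) ↔ S a b) (m : ℕ) :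
    Nat.card {c : I → Fin m // ∀ i j, R i j → S (c i) (c j)} =
      (relMaps R S Finset.univ m).card := by
  rw [← Fintype.card_coe, ← Nat.card_eq_fintype_card]
  -- Colors shift by one because `Fin m` starts at `0`.
  refine Nat.card_eq_of_bijective (fun c => ⟨fun i => (c.1 i : ℕ) + 1, mem_relMaps.2
    ⟨fun i _ => ⟨by omega, (c.1 i).isLt⟩, by simp, fun i _ j _ hij =>
      (hS _ _).2 (c.2 i j hij)⟩⟩) ⟨?_, ?_⟩
  · intro c c' heq
    refine Subtype.ext (funext fun i => Fin.ext ?_)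
    simpa using congrFun (congrArg Subtype.val heq) i
  · rintro ⟨c, hc⟩
    obtain ⟨h1, -, h3⟩ := mem_relMaps.1 hc
    have h1' : ∀ i, c i - 1 + 1 = c i := fun i => Nat.sub_add_cancel (h1 i (Finset.mem_univ i)).1
    refine ⟨⟨fun i => ⟨c i - 1, by have := h1 i (Finset.mem_univ i); omega⟩,
      fun i j hij => ?_⟩, Subtype.ext (funext h1')⟩
    rw [← hS]
    simpa only [h1'] using h3 i (Finset.mem_univ i) j (Finset.mem_univ j) hij

end OrderPolynomial

/-! ### Acyclic headings and their colorings -/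

namespace MultiHypergraph

open OrderPolynomial

variable {I : Type*} [DecidableEq I] {h : MultiHypergraph I}

instance [Finite I] : Finite h.Heading :=
  inferInstanceAs (Finite {σ : h.Edge → I // ∀ e : h.Edge, σ e ∈ e.1})

namespace Heading

/-- The head of a hyperedge lies above its other nodes. -/
def Below (σ : h.Heading) (i j : I) : Prop :=
  ∃ e : h.Edge, σ.head e = j ∧ i ∈ e.1 ∧ i ≠ j

/-- Without a maximal element, one climbs forever inside `A`; the hyperedges used must repeat, and
the stretch between two repetitions is an oriented cycle. -/
theorem IsAcyclic.hasMaxElems {σ : h.Heading} (hσ : σ.IsAcyclic) : HasMaxElems σ.Below := by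
  intro A ⟨i₀, hi₀⟩
  by_contra! hcon
  choose! f hfA hf using hcon
  have hA : ∀ n, f^[n] i₀ ∈ A := fun n => by
    induction n with
    | zero => exact hi₀
    | succ n ih => rw [Function.iterate_succ_apply']; exact hfA _ ih
  have hedge : ∀ n, ∃ e : h.Edge,
      σ.head e = f^[n + 1] i₀ ∧ f^[n] i₀ ∈ e.1 ∧ f^[n] i₀ ≠ f^[n + 1] i₀ := fun n => by
    rw [Function.iterate_succ_apply']
    exact hf _ (hA n)
  choose e he using hedge
  have hstep : ∀ n, σ.head (e n) ∈ (e (n + 1)).1 \ {σ.head (e (n + 1))} := fun n => by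
    rw [Finset.mem_sdiff, Finset.mem_singleton, (he n).1, (he (n + 1)).1]
    exact (he (n + 1)).2
  obtain ⟨a, b, hab, heq⟩ : ∃ a b, a < b ∧ e a = e b := by
    obtain ⟨a, b, hne, heq⟩ := Finite.exists_ne_map_eq_of_infinite e
    rcases hne.lt_or_gt with hlt | hlt
    · exact ⟨a, b, hlt, heq⟩
    · exact ⟨b, a, hlt, heq.symm⟩
  obtain ⟨n, rfl⟩ : ∃ n, b = a + n + 1 := ⟨b - a - 1, by omega⟩
  refine hσ ⟨n, fun i => e (a + i), fun i => ?_⟩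
  have hs := hstep (a + i)
  -- At the last index the cycle wraps around, by `e a = e (a + n + 1)`.
  by_cases hi : i = Fin.last n
  · subst hi
    simpa [← heq] using hs
  · have : ((i + 1 : Fin (n + 1)) : ℕ) = i + 1 := by
      rw [Fin.val_add_one, if_neg hi]
    simpa only [this, ← add_assoc] using hs

/-- Along an oriented cycle the colors of the heads would increase strictly, so none could be
largest. -/
theorem isAcyclic_of_strict {σ : h.Heading} {m : ℕ} {c : I → Fin m}
    (hc : ∀ i j, σ.Below i j → c i < c j) : σ.IsAcyclic := by
  rintro ⟨n, e, he⟩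
  obtain ⟨i, hi⟩ := Finite.exists_max fun i => c (σ.head (e i))
  have := he i
  rw [Finset.mem_sdiff, Finset.mem_singleton] at this
  exact absurd (hi (i + 1)) (not_le.2 (hc _ _ ⟨_, rfl, this.1, this.2⟩))

theorem compatible_iff {σ : h.Heading} {m : ℕ} {c : I → Fin m} :
    Compatible σ c ↔ ∀ i j, σ.Below i j → c i ≤ c j := by
  constructor
  · rintro hc i _ ⟨e, rfl, hi, -⟩
    exact (hc e).2 i hi
  · refine fun hc e => ⟨σ.2 e, fun j hj => ?_⟩
    by_cases hje : j = σ.head e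
    · rw [hje]
    · exact hc _ _ ⟨e, rfl, hj, hje⟩

theorem isMaximalNode_iff_of_strict {σ : h.Heading} {m : ℕ} {c : I → Fin m}
    (hc : ∀ i j, σ.Below i j → c i < c j) (e : h.Edge) (i : I) :
    IsMaximalNode c e.1 i ↔ i = σ.head e := by
  constructor
  · rintro ⟨hi, hmax⟩
    by_contra hne
    exact absurd (hmax _ (σ.2 e)) (not_le.2 (hc _ _ ⟨e, rfl, hi, hne⟩))
  · rintro rfl
    exact compatible_iff.2 (fun i j hij => (hc i j hij).le) e

end Heading

open Heading

theorem isProperColoring_iff {m : ℕ} {c : I → Fin m} :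
    h.IsProperColoring c ↔ ∀ e : h.Edge, ∃! i : I, IsMaximalNode c e.1 i :=
  ⟨fun hc _ => hc _ Multiset.coe_mem,
    fun hc _ he => hc ⟨_, 0, Multiset.count_pos.2 he⟩⟩

/-- A proper coloring is strictly increasing for exactly one heading, which is acyclic. -/
noncomputable def sigmaEquivProperColoring (h : MultiHypergraph I) (m : ℕ) :
    (Σ σ : {σ : h.Heading // σ.IsAcyclic},
      {c : I → Fin m // ∀ i j, σ.1.Below i j → (c i : ℕ) < c j}) ≃
      {c : I → Fin m // h.IsProperColoring c} := by
  refine Equiv.ofBijective (fun p => ⟨p.2.1, isProperColoring_iff.2 fun e =>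
    ⟨p.1.1.head e, (isMaximalNode_iff_of_strict p.2.2 e _).2 rfl,
      fun i hi => (isMaximalNode_iff_of_strict p.2.2 e i).1 hi⟩⟩) ⟨?_, ?_⟩
  · rintro ⟨⟨σ, hσ⟩, c, hc⟩ ⟨⟨τ, hτ⟩, c', hc'⟩ heq
    obtain rfl : c = c' := congrArg Subtype.val heq
    obtain rfl : σ = τ := Subtype.ext <| funext fun e =>
      (isMaximalNode_iff_of_strict hc' e _).1 ((isMaximalNode_iff_of_strict hc e _).2 rfl)
    rfl
  · rintro ⟨c, hc⟩
    choose f hf huniq using isProperColoring_iff.1 hc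
    let σ : h.Heading := ⟨f, fun e => (hf e).1⟩
    have hσ : ∀ i j, σ.Below i j → c i < c j := by
      rintro i _ ⟨e, rfl, hi, hne⟩
      -- A node with the same color as the head would be a second maximal node.
      refine lt_of_le_of_ne ((hf e).2 i hi) fun hci => hne (huniq e i ⟨hi, fun j hj => ?_⟩)
      exact hci ▸ (hf e).2 j hj
    exact ⟨⟨⟨σ, isAcyclic_of_strict hσ⟩, c, hσ⟩, rfl⟩

/-- Compatible pairs, grouped by the heading. -/
def sigmaEquivCompatible (h : MultiHypergraph I) (m : ℕ) :
    (Σ σ : {σ : h.Heading // σ.IsAcyclic},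
      {c : I → Fin m // ∀ i j, σ.1.Below i j → (c i : ℕ) ≤ c j}) ≃
      {p : h.Heading × (I → Fin m) // p.1.IsAcyclic ∧ Compatible p.1 p.2} where
  toFun p := ⟨(p.1.1, p.2.1), p.1.2, compatible_iff.2 p.2.2⟩
  invFun p := ⟨⟨p.1.1, p.2.1⟩, p.1.2, compatible_iff.1 p.2.2⟩
  left_inv _ := rfl
  right_inv _ := rfl

theorem exists_coloringPolynomial [Fintype I] (h : MultiHypergraph I) :
    ∃ χ : ℚ[X], h.IsColoringPolynomial χ ∧ ∀ m : ℕ,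
      (-1 : ℚ) ^ Fintype.card I * χ.eval (-(m : ℚ)) =
        (Nat.card {p : h.Heading × (I → Fin m) // p.1.IsAcyclic ∧ Compatible p.1 p.2} : ℚ) := by
  choose P hP hQ using fun σ : {σ : h.Heading // σ.IsAcyclic} =>
    exists_reciprocity σ.2.hasMaxElems Finset.univ
  have := Fintype.ofFinite {σ : h.Heading // σ.IsAcyclic}
  refine ⟨∑ σ, P σ, fun m _ => ?_, fun m => ?_⟩
  · rw [← Nat.card_congr (sigmaEquivProperColoring h m), Nat.card_sigma, eval_finsetSum]
    push_cast
    refine Finset.sum_congr rfl fun σ _ => ?_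
    rw [hP, ← natCard_eq_card_relMaps _ _ (fun a b => by simp)]
  · rw [← Nat.card_congr (sigmaEquivCompatible h m), Nat.card_sigma, eval_finsetSum,
      Finset.mul_sum]
    push_cast
    refine Finset.sum_congr rfl fun σ _ => ?_
    rw [natCard_eq_card_relMaps _ (· ≤ ·) (fun a b => by simp), ← hQ, Finset.card_univ]

theorem IsColoringPolynomial.eq {I : Type*} {h : MultiHypergraph I} {χ χ' : ℚ[X]} (hχ : h.IsColoringPolynomial χ)
    (hχ' : h.IsColoringPolynomial χ') : χ = χ' := by
  -- The values are prescribed at the infinitely many points `n + 1`.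
  refine Polynomial.eq_of_infinite_eval_eq _ _ (Set.infinite_of_injective_forall_mem
    (f := fun n : ℕ => ((n + 1 : ℕ) : ℚ)) (fun a b hab => ?_) fun n => ?_)
  · simpa using hab
  · exact (hχ _ n.succ_pos).trans (hχ' _ n.succ_pos).symm

/-- The only coloring with one color is constant, hence compatible with every heading. -/
theorem natCard_compatible_one (h : MultiHypergraph I) :
    Nat.card {p : h.Heading × (I → Fin 1) // p.1.IsAcyclic ∧ Compatible p.1 p.2} =
      Nat.card {σ : h.Heading // σ.IsAcyclic} :=
  Nat.card_congr
    { toFun := fun p => ⟨p.1.1, p.2.1⟩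
      invFun := fun σ => ⟨(σ.1, fun _ => 0), σ.2, fun e => ⟨σ.1.2 e, fun _ _ => le_rfl⟩⟩
      left_inv := fun _ => Subtype.ext (Prod.ext rfl (Subsingleton.elim _ _))
      right_inv := fun _ => rfl }

end MultiHypergraph

theorem mainTheorem4 {I : Type*} [Fintype I] [DecidableEq I] (h : MultiHypergraph I) :
    (∃! χ : ℚ[X], h.IsColoringPolynomial χ) ∧
    ∀ χ : ℚ[X], h.IsColoringPolynomial χ →
      (∀ m : ℕ, 0 < m →
        (-1 : ℚ) ^ Fintype.card I * χ.eval (-(m : ℚ)) =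
          (Nat.card {p : h.Heading × (I → Fin m) //
            p.1.IsAcyclic ∧ MultiHypergraph.Compatible p.1 p.2} : ℚ)) ∧
      (-1 : ℚ) ^ Fintype.card I * χ.eval (-1) =
        (Nat.card {σ : h.Heading // σ.IsAcyclic} : ℚ) := by
  obtain ⟨χ₀, hχ₀, hrec⟩ := h.exists_coloringPolynomial
  refine ⟨⟨χ₀, hχ₀, fun χ hχ => hχ.eq hχ₀⟩, fun χ hχ => ?_⟩
  obtain rfl := hχ.eq hχ₀
  refine ⟨fun m _ => hrec m, ?_⟩
  rw [← h.natCard_compatible_one, ← hrec 1, Nat.cast_one]
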